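/- For a complex algebra $A$ with bilinear multiplication $(x,y)\mapsto xy$ let $\mathrm{Der}(A)$ be the space of linear maps $d:A\to A$ with $d(xy)=d(x)y+x\,d(y)$ for all $x,y\in A$, $\mathrm{Cent}(A)$ the space of linear maps $\varphi:A\to A$ with $\varphi(xy)=\varphi(x)y=x\varphi(y)$ for all $x,y\in A$, and $\mathrm{Inn}(A)$ the space of maps $x\mapsto wx-xw$ with $w\in A$. Consider the following 31 five-dimensional complex nilpotent, non-2-step nilpotent, non-commutative associative algebras (four of them are one-parameter families). Each has basis $e_1,\dots,e_5$, and all products of basis vectors that are not listed are zero: - $A_{1}$: $e_1e_1=e_2$, $e_1e_2=e_4$, $e_1e_3=e_4$, $e_2e_1=e_4$, $e_3e_3=e_4$; - $A_{2}$: $e_1e_1=e_2$, $e_1e_2=e_4$, $e_1e_3=e_4$, $e_2e_1=e_4$; - $A_{3}$: $e_1e_1=e_2$, $e_1e_2=e_3$, $e_1e_3=e_4$, $e_1e_5=e_4$, $e_2e_1=e_3$, $e_2e_2=e_4$, $e_3e_1=e_4$; - $A_{4}$: $e_1e_1=e_2$, $e_1e_2=e_3$, $e_1e_3=e_4$, $e_1e_5=e_4$,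 $e_2e_1=e_3$, $e_2e_2=e_4$, $e_3e_1=e_4$, $e_5e_5=e_4$; - $A_{5}$: $e_1e_1=e_2$, $e_1e_2=e_3$, $e_1e_4=e_3$, $e_2e_1=e_3$, $e_4e_5=e_3$, $e_5e_4=e_3$; - $A_{6}$: $e_1e_1=e_2$, $e_1e_2=e_3$, $e_1e_4=e_3$, $e_2e_1=e_3$, $e_5e_5=e_3$; - $A_{7}$: $e_1e_1=e_2$, $e_1e_2=e_3$, $e_1e_4=e_3$, $e_2e_1=e_3$, $e_4e_4=e_3$, $e_5e_5=e_3$; - $A_{8}$: $e_1e_1=e_2$, $e_1e_2=e_3$, $e_2e_1=e_3$, $e_4e_5=e_3$, $e_5e_4=-e_3$, $e_5e_5=e_3$; - $A_{9}(\alpha)$: $e_1e_1=e_2$, $e_1e_2=e_3$, $e_2e_1=e_3$, $e_4e_5=e_3$, $e_5e_4=\alpha e_3$ (for $\alpha\in\mathbb{C}$, $\alpha\neq1$); - $A_{10}$: $e_1e_1=e_2$, $e_1e_2=e_3$, $e_2e_1=e_3$, $e_4e_1=e_5$; - $A_{11}$: $e_1e_1=e_2$, $e_1e_2=e_3$, $e_2e_1=e_3$,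 $e_4e_1=e_3$, $e_4e_4=e_3$; - $A_{12}$: $e_1e_1=e_2$, $e_1e_2=e_3$, $e_2e_1=e_3$, $e_4e_1=e_5$, $e_4e_2=e_3$, $e_5e_1=e_3$; - $A_{13}$: $e_1e_1=e_2$, $e_1e_2=e_3$, $e_2e_1=e_3$, $e_4e_1=e_5$, $e_4e_2=e_3$, $e_4e_4=e_3$, $e_5e_1=e_3$; - $A_{14}$: $e_1e_1=e_2$, $e_1e_2=e_3$, $e_1e_4=e_5$, $e_2e_1=e_3$, $e_4e_1=e_3 + e_5$; - $A_{15}$: $e_1e_1=e_2$, $e_1e_2=e_3$, $e_1e_4=e_5$, $e_2e_1=e_3$, $e_4e_1=e_3 + e_5$, $e_4e_4=e_3$; - $A_{16}(\alpha)$: $e_1e_1=e_2$, $e_1e_2=e_3$, $e_1e_4=e_5$, $e_2e_1=e_3$, $e_4e_1=\alpha e_5$ (for $\alpha\in\mathbb{C}$, $\alpha\neq1$); - $A_{17}(\alpha)$: $e_1e_1=e_2$, $e_1e_2=e_3$, $e_1e_4=e_5$, $e_2e_1=e_3$, $e_4e_1=\alpha e_5$, $e_4e_4=e_3$ (for $\alpha\in\mathbb{C}$,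 $\alpha\neq1$); - $A_{18}$: $e_1e_1=e_2$, $e_1e_2=e_3$, $e_2e_1=e_3$, $e_4e_1=e_3$, $e_4e_4=e_5$; - $A_{19}$: $e_1e_1=e_2$, $e_1e_2=e_3$, $e_1e_4=e_3$, $e_2e_1=e_3$, $e_4e_4=e_5$; - $A_{20}$: $e_1e_1=e_2$, $e_1e_2=e_3$, $e_1e_4=e_5$, $e_2e_1=e_3$, $e_4e_4=e_3 + e_5$; - $A_{21}$: $e_1e_1=e_2$, $e_1e_2=e_3$, $e_1e_4=e_5$, $e_2e_1=e_3$, $e_4e_1=e_2 - e_5$, $e_5e_1=e_3$; - $A_{22}$: $e_1e_1=e_2$, $e_1e_2=e_3$, $e_1e_4=e_5$, $e_2e_1=e_3$, $e_4e_1=e_2 - e_5$, $e_4e_4=e_3$, $e_5e_1=e_3$; - $A_{23}$: $e_1e_1=e_2$, $e_1e_2=e_3$, $e_1e_4=e_5$, $e_2e_1=e_3$, $e_4e_1=e_2 + e_5$, $e_4e_2=2e_3$, $e_4e_4=2e_5$, $e_5e_1=e_3$; - $A_{24}$: $e_1e_1=e_2$, $e_1e_2=e_3$, $e_1e_4=e_5$,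 $e_2e_1=e_3$, $e_4e_1=e_2 + e_5$, $e_4e_2=2e_3$, $e_4e_4=e_3 + 2e_5$, $e_5e_1=e_3$; - $A_{25}$: $e_1e_1=e_2$, $e_1e_2=e_3$, $e_1e_4=e_5$, $e_2e_1=e_3$, $e_4e_1=e_3 + e_5$, $e_4e_4=e_2$, $e_4e_5=e_3$, $e_5e_4=e_3$; - $A_{26}$: $e_1e_1=e_2$, $e_1e_2=e_3$, $e_1e_4=e_5$, $e_2e_1=e_3$, $e_4e_1=-e_5$, $e_4e_4=e_2$, $e_4e_5=-e_3$, $e_5e_4=e_3$; - $A_{27}$: $e_1e_1=e_2$, $e_1e_2=e_3$, $e_1e_4=e_5$, $e_2e_1=e_3$, $e_4e_1=e_2$, $e_4e_2=e_3$, $e_4e_4=e_3 + e_5$, $e_5e_1=e_3$; - $A_{28}$: $e_1e_1=e_2$, $e_1e_2=e_3$, $e_1e_4=e_5$, $e_2e_1=e_3$, $e_4e_1=e_3 + e_5$, $e_4e_4=-e_2 + 2e_5$, $e_4e_5=-e_3$, $e_5e_4=-e_3$; - $A_{29}$: $e_1e_1=e_2$, $e_1e_2=e_3$, $e_1e_4=e_5$,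 $e_2e_1=e_3$, $e_4e_1=(1 - i)e_2 + ie_5$, $e_4e_2=2e_3$, $e_4e_4=-ie_2 + e_3 + (1 + i)e_5$, $e_4e_5=e_3$, $e_5e_1=(1 - i)e_3$, $e_5e_4=-ie_3$; - $A_{30}$: $e_1e_1=e_2$, $e_1e_2=e_3$, $e_1e_4=e_5$, $e_2e_1=e_3$, $e_4e_1=(1 + i)e_2 - ie_5$, $e_4e_2=2e_3$, $e_4e_4=ie_2 + e_3 + (1 - i)e_5$, $e_4e_5=e_3$, $e_5e_1=(1 + i)e_3$, $e_5e_4=ie_3$; - $A_{31}(\alpha)$: $e_1e_1=e_2$, $e_1e_2=e_3$, $e_1e_4=e_5$, $e_2e_1=e_3$, $e_4e_1=(1 - \alpha)e_2 + \alpha e_5$, $e_4e_2=(1 - \alpha^2)e_3$, $e_4e_4=-\alpha e_2 + (1 + \alpha)e_5$, $e_4e_5=-\alpha^2e_3$, $e_5e_1=(1 - \alpha)e_3$, $e_5e_4=-\alpha e_3$ (for $\alpha\in\mathbb{C}$, $\alpha\neq1$). Then every algebra $A$ in this list (for every admissible value of $\alpha$) satisfies $$2\le\dim\mathrm{Der}(A)\le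 9,\qquad 2\le\dim\mathrm{Cent}(A)\le 8,\qquad 2\le\dim\mathrm{Inn}(A)\le 4 .$$ Moreover, in this list the values $\dim\mathrm{Der}(A)=9$, $\dim\mathrm{Cent}(A)=8$, $\dim\mathrm{Inn}(A)=2$ and $\dim\mathrm{Inn}(A)=4$ are attained. -/

import Mathlib

namespace NilpFive

section Bilinear

variable {V : Type*} [AddCommGroup V] [Module ℂ V]

/-- The space `Der(A)` of derivations of the algebra with underlying space `V` and
multiplication `μ`: linear maps `d` with `d (x y) = d x y + x d y`. -/
def derivations (μ : V →ₗ[ℂ] V →ₗ[ℂ] V) : Submodule ℂ (V →ₗ[ℂ] V) where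
  carrier := {d | ∀ x y, d (μ x y) = μ (d x) y + μ x (d y)}
  zero_mem' := by intro x y; simp
  add_mem' := by
    intro c d hc hd x y
    simp only [LinearMap.add_apply, map_add, hc x y, hd x y]
    abel
  smul_mem' := by
    intro a d hd x y
    simp only [LinearMap.smul_apply, map_smul, hd x y, smul_add]

/-- The centroid `Cent(A)`: linear maps `φ` with `φ (x y) = φ x y = x φ y`. -/
def centroid (μ : V →ₗ[ℂ] V →ₗ[ℂ] V) : Submodule ℂ (V →ₗ[ℂ] V) where
  carrier := {φ | ∀ x y, φ (μ x y) = μ (φ x) y ∧ φ (μ x y) = μ x (φ y)}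
  zero_mem' := by intro x y; simp
  add_mem' := by
    intro c d hc hd x y
    constructor
    · simp only [LinearMap.add_apply, map_add, (hc x y).1, (hd x y).1]
    · simp only [LinearMap.add_apply, map_add, (hc x y).2, (hd x y).2]
  smul_mem' := by
    intro a d hd x y
    constructor
    · simp only [LinearMap.smul_apply, map_smul, (hd x y).1]
    · simp only [LinearMap.smul_apply, map_smul, (hd x y).2]

/-- The space `Inn(A)` of inner derivations: all maps `x ↦ w x - x w` with `w` in the algebra. -/
def innerDerivations (μ : V →ₗ[ℂ] V →ₗ[ℂ] V) : Submodule ℂ (V →ₗ[ℂ] V) :=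
  LinearMap.range (μ - μ.flip)

theorem mem_innerDerivations (μ : V →ₗ[ℂ] V →ₗ[ℂ] V) (d : V →ₗ[ℂ] V) :
    d ∈ innerDerivations μ ↔ ∃ w, ∀ x, d x = μ w x - μ x w := by
  constructor
  · rintro ⟨w, rfl⟩
    exact ⟨w, fun x => rfl⟩
  · rintro ⟨w, hw⟩
    exact ⟨w, LinearMap.ext fun x => (hw x).symm⟩

end Bilinear

/-- The underlying space of the algebras, with standard basis `e₁, …, e₅`. -/
abbrev V5 : Type := Fin 5 → ℂ

def e2 : V5 := ![0, 1, 0, 0, 0]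
def e3 : V5 := ![0, 0, 1, 0, 0]
def e4 : V5 := ![0, 0, 0, 1, 0]
def e5 : V5 := ![0, 0, 0, 0, 1]

/-- Labels of the 31 five-dimensional complex nilpotent, non-2-step nilpotent, non-commutative
associative algebras. Four of them are families with a parameter `α`; at `α = 1`
these are commutative, so this value is excluded. -/
inductive Label : Type
  | A1
  | A2
  | A3
  | A4
  | A5
  | A6
  | A7
  | A8
  | A9 (α : ℂ) (hα : α ≠ 1)
  | A10
  | A11
  | A12
  | A13
  | A14
  | A15
  | A16 (α : ℂ) (hα : α ≠ 1)
  | A17 (α : ℂ) (hα : α ≠ 1)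
  | A18
  | A19
  | A20
  | A21
  | A22
  | A23
  | A24
  | A25
  | A26
  | A27
  | A28
  | A29
  | A30
  | A31 (α : ℂ) (hα : α ≠ 1)

open Complex in
/-- The multiplication table: row `i`, column `j` is the product `e_i e_j` of basis vectors. -/
noncomputable def table : Label → Matrix (Fin 5) (Fin 5) V5
  | .A1 =>
    !![e2, e4, e4, 0, 0;
       e4, 0, 0, 0, 0;
       0, 0, e4, 0, 0;
       0, 0, 0, 0, 0;
       0, 0, 0, 0, 0]
  | .A2 =>
    !![e2, e4, e4, 0, 0;
       e4, 0, 0, 0, 0;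
       0, 0, 0, 0, 0;
       0, 0, 0, 0, 0;
       0, 0, 0, 0, 0]
  | .A3 =>
    !![e2, e3, e4, 0, e4;
       e3, e4, 0, 0, 0;
       e4, 0, 0, 0, 0;
       0, 0, 0, 0, 0;
       0, 0, 0, 0, 0]
  | .A4 =>
    !![e2, e3, e4, 0, e4;
       e3, e4, 0, 0, 0;
       e4, 0, 0, 0, 0;
       0, 0, 0, 0, 0;
       0, 0, 0, 0, e4]
  | .A5 =>
    !![e2, e3, 0, e3, 0;
       e3, 0, 0, 0, 0;
       0, 0, 0, 0, 0;
       0, 0, 0, 0, e3;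
       0, 0, 0, e3, 0]
  | .A6 =>
    !![e2, e3, 0, e3, 0;
       e3, 0, 0, 0, 0;
       0, 0, 0, 0, 0;
       0, 0, 0, 0, 0;
       0, 0, 0, 0, e3]
  | .A7 =>
    !![e2, e3, 0, e3, 0;
       e3, 0, 0, 0, 0;
       0, 0, 0, 0, 0;
       0, 0, 0, e3, 0;
       0, 0, 0, 0, e3]
  | .A8 =>
    !![e2, e3, 0, 0, 0;
       e3, 0, 0, 0, 0;
       0, 0, 0, 0, 0;
       0, 0, 0, 0, e3;
       0, 0, 0, -e3, e3]
  | .A9 α _ =>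
    !![e2, e3, 0, 0, 0;
       e3, 0, 0, 0, 0;
       0, 0, 0, 0, 0;
       0, 0, 0, 0, e3;
       0, 0, 0, α • e3, 0]
  | .A10 =>
    !![e2, e3, 0, 0, 0;
       e3, 0, 0, 0, 0;
       0, 0, 0, 0, 0;
       e5, 0, 0, 0, 0;
       0, 0, 0, 0, 0]
  | .A11 =>
    !![e2, e3, 0, 0, 0;
       e3, 0, 0, 0, 0;
       0, 0, 0, 0, 0;
       e3, 0, 0, e3, 0;
       0, 0, 0, 0, 0]
  | .A12 =>
    !![e2, e3, 0, 0, 0;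
       e3, 0, 0, 0, 0;
       0, 0, 0, 0, 0;
       e5, e3, 0, 0, 0;
       e3, 0, 0, 0, 0]
  | .A13 =>
    !![e2, e3, 0, 0, 0;
       e3, 0, 0, 0, 0;
       0, 0, 0, 0, 0;
       e5, e3, 0, e3, 0;
       e3, 0, 0, 0, 0]
  | .A14 =>
    !![e2, e3, 0, e5, 0;
       e3, 0, 0, 0, 0;
       0, 0, 0, 0, 0;
       e3 + e5, 0, 0, 0, 0;
       0, 0, 0, 0, 0]
  | .A15 =>
    !![e2, e3, 0, e5, 0;
       e3, 0, 0, 0, 0;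
       0, 0, 0, 0, 0;
       e3 + e5, 0, 0, e3, 0;
       0, 0, 0, 0, 0]
  | .A16 α _ =>
    !![e2, e3, 0, e5, 0;
       e3, 0, 0, 0, 0;
       0, 0, 0, 0, 0;
       α • e5, 0, 0, 0, 0;
       0, 0, 0, 0, 0]
  | .A17 α _ =>
    !![e2, e3, 0, e5, 0;
       e3, 0, 0, 0, 0;
       0, 0, 0, 0, 0;
       α • e5, 0, 0, e3, 0;
       0, 0, 0, 0, 0]
  | .A18 =>
    !![e2, e3, 0, 0, 0;
       e3, 0, 0, 0, 0;
       0, 0, 0, 0, 0;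
       e3, 0, 0, e5, 0;
       0, 0, 0, 0, 0]
  | .A19 =>
    !![e2, e3, 0, e3, 0;
       e3, 0, 0, 0, 0;
       0, 0, 0, 0, 0;
       0, 0, 0, e5, 0;
       0, 0, 0, 0, 0]
  | .A20 =>
    !![e2, e3, 0, e5, 0;
       e3, 0, 0, 0, 0;
       0, 0, 0, 0, 0;
       0, 0, 0, e3 + e5, 0;
       0, 0, 0, 0, 0]
  | .A21 =>
    !![e2, e3, 0, e5, 0;
       e3, 0, 0, 0, 0;
       0, 0, 0, 0, 0;
       e2 - e5, 0, 0, 0, 0;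
       e3, 0, 0, 0, 0]
  | .A22 =>
    !![e2, e3, 0, e5, 0;
       e3, 0, 0, 0, 0;
       0, 0, 0, 0, 0;
       e2 - e5, 0, 0, e3, 0;
       e3, 0, 0, 0, 0]
  | .A23 =>
    !![e2, e3, 0, e5, 0;
       e3, 0, 0, 0, 0;
       0, 0, 0, 0, 0;
       e2 + e5, (2 : ℂ) • e3, 0, (2 : ℂ) • e5, 0;
       e3, 0, 0, 0, 0]
  | .A24 =>
    !![e2, e3, 0, e5, 0;
       e3, 0, 0, 0, 0;
       0, 0, 0, 0, 0;
       e2 + e5, (2 : ℂ) • e3, 0, e3 + (2 : ℂ) • e5, 0;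
       e3, 0, 0, 0, 0]
  | .A25 =>
    !![e2, e3, 0, e5, 0;
       e3, 0, 0, 0, 0;
       0, 0, 0, 0, 0;
       e3 + e5, 0, 0, e2, e3;
       0, 0, 0, e3, 0]
  | .A26 =>
    !![e2, e3, 0, e5, 0;
       e3, 0, 0, 0, 0;
       0, 0, 0, 0, 0;
       -e5, 0, 0, e2, -e3;
       0, 0, 0, e3, 0]
  | .A27 =>
    !![e2, e3, 0, e5, 0;
       e3, 0, 0, 0, 0;
       0, 0, 0, 0, 0;
       e2, e3, 0, e3 + e5, 0;
       e3, 0, 0, 0, 0]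
  | .A28 =>
    !![e2, e3, 0, e5, 0;
       e3, 0, 0, 0, 0;
       0, 0, 0, 0, 0;
       e3 + e5, 0, 0, -e2 + (2 : ℂ) • e5, -e3;
       0, 0, 0, -e3, 0]
  | .A29 =>
    !![e2, e3, 0, e5, 0;
       e3, 0, 0, 0, 0;
       0, 0, 0, 0, 0;
       (1 - I) • e2 + I • e5, (2 : ℂ) • e3, 0, (-I) • e2 + e3 + (1 + I) • e5, e3;
       (1 - I) • e3, 0, 0, (-I) • e3, 0]
  | .A30 =>
    !![e2, e3, 0, e5, 0;
       e3, 0, 0, 0, 0;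
       0, 0, 0, 0, 0;
       (1 + I) • e2 - I • e5, (2 : ℂ) • e3, 0, I • e2 + e3 + (1 - I) • e5, e3;
       (1 + I) • e3, 0, 0, I • e3, 0]
  | .A31 α _ =>
    !![e2, e3, 0, e5, 0;
       e3, 0, 0, 0, 0;
       0, 0, 0, 0, 0;
       (1 - α) • e2 + α • e5, (1 - α ^ 2) • e3, 0, (-α) • e2 + (1 + α) • e5, (-α ^ 2) • e3;
       (1 - α) • e3, 0, 0, (-α) • e3, 0]

/-- The multiplication: bilinear extension of the multiplication table. -/
noncomputable def mul (A : Label) : V5 →ₗ[ℂ] V5 →ₗ[ℂ] V5 :=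
  LinearMap.mk₂ ℂ (fun x y => ∑ i, ∑ j, (x i * y j) • table A i j)
    (fun x x' y => by simp only [Pi.add_apply, add_mul, add_smul, Finset.sum_add_distrib])
    (fun c x y => by
      simp only [Pi.smul_apply, smul_eq_mul, Finset.smul_sum, smul_smul, mul_assoc])
    (fun x y y' => by simp only [Pi.add_apply, mul_add, add_smul, Finset.sum_add_distrib])
    (fun c x y => by
      simp only [Pi.smul_apply, smul_eq_mul, Finset.smul_sum, smul_smul, mul_left_comm])

end NilpFive

/-! The lower bounds are structural. If `x` and `y` do not commute, evaluating a linear relation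
between their inner derivations at `x` and at `y` shows that it is trivial, so dim Inn ≥ 2;
associativity puts Inn inside Der. The centroid contains the identity and the rank one map sending
`x` to its `e1`-coordinate times an annihilator element. Since the kernel of `w ↦ (x ↦ w x - x w)`
is the centre, which is nonzero, dim Inn ≤ 4.

The upper bounds for Der and Cent come from `finrank_le_card`: a map is determined by its values on
generators, and some coefficients of these are redundant. When `e1` and `e4` generate, there are ten
coefficients. One is redundant for a derivation and two for a centroid element, which gives 9 and 8
uniformly. `A1` to `A9` and `A11` are not generated by `e1` and `e4`, and need their own lists of
coefficients.

The extreme values for Der and Cent are attained at `A2`, by explicit injective parametrisations. -/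

namespace NilpFive

/-! ### Dimension estimates for an arbitrary bilinear multiplication. -/

section General

variable {V : Type*} [AddCommGroup V] [Module ℂ V]

theorem innerDerivations_le_derivations (μ : V →ₗ[ℂ] V →ₗ[ℂ] V)
    (hμ : ∀ x y z, μ (μ x y) z = μ x (μ y z)) : innerDerivations μ ≤ derivations μ := by
  intro d hd x y
  obtain ⟨w, hw⟩ := (mem_innerDerivations μ d).1 hd
  simp only [hw, map_sub, LinearMap.sub_apply, hμ]
  abel

theorem id_mem_centroid (μ : V →ₗ[ℂ] V →ₗ[ℂ] V) : LinearMap.id ∈ centroid μ :=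
  fun _ _ => ⟨rfl, rfl⟩

/-- A rank one map vanishing on products, with values in the annihilator, is in the centroid. -/
theorem smulRight_mem_centroid (μ : V →ₗ[ℂ] V →ₗ[ℂ] V) (f : V →ₗ[ℂ] ℂ) (z : V)
    (hf : ∀ x y, f (μ x y) = 0) (hl : ∀ x, μ z x = 0) (hr : ∀ x, μ x z = 0) :
    f.smulRight z ∈ centroid μ := by
  intro x y
  simp [hf, hl, hr]

variable [FiniteDimensional ℂ V]

theorem two_le_finrank {W : Submodule ℂ (V →ₗ[ℂ] V)} {f g : V →ₗ[ℂ] V} (hf : f ∈ W) (hg : g ∈ W)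
    (h : ∀ s t : ℂ, s • f + t • g = 0 → s = 0 ∧ t = 0) : 2 ≤ Module.finrank ℂ W := by
  have hli : LinearIndependent ℂ ![(⟨f, hf⟩ : W), ⟨g, hg⟩] := by
    rw [LinearIndependent.pair_iff]
    intro s t hst
    exact h s t (congrArg Subtype.val hst)
  simpa using hli.fintype_card_le_finrank

theorem two_le_finrank_centroid (μ : V →ₗ[ℂ] V →ₗ[ℂ] V) (f : V →ₗ[ℂ] ℂ) (z : V) (hz : z ≠ 0)
    (hf0 : f ≠ 0) (hfz : f z = 0) (hf : ∀ x y, f (μ x y) = 0) (hl : ∀ x, μ z x = 0)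
    (hr : ∀ x, μ x z = 0) : 2 ≤ Module.finrank ℂ (centroid μ) := by
  refine two_le_finrank (id_mem_centroid μ) (smulRight_mem_centroid μ f z hf hl hr) ?_
  intro s t hst
  -- At `z` the rank one map vanishes because `f z = 0`, so only the identity contributes.
  have h1 : s = 0 := by simpa [hfz, hz] using LinearMap.congr_fun hst z
  obtain ⟨x, hx⟩ := DFunLike.ne_iff.1 hf0
  have h2 : t = 0 := by
    have := LinearMap.congr_fun hst x
    simp only [h1, zero_smul, zero_add, LinearMap.smul_apply, LinearMap.smulRight_apply,
      LinearMap.zero_apply, smul_smul, smul_eq_zero, mul_eq_zero, hz, or_false] at this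
    exact this.resolve_right hx
  exact ⟨h1, h2⟩

/-- Two elements that do not commute have linearly independent inner derivations. -/
theorem two_le_finrank_innerDerivations (μ : V →ₗ[ℂ] V →ₗ[ℂ] V) (x y : V) (h : μ x y ≠ μ y x) :
    2 ≤ Module.finrank ℂ (innerDerivations μ) := by
  refine two_le_finrank (LinearMap.mem_range_self _ x) (LinearMap.mem_range_self _ y) ?_
  intro s t hst
  have h1 := LinearMap.congr_fun hst x
  have h2 := LinearMap.congr_fun hst y
  simp [sub_eq_zero, h, h.symm] at h1 h2
  exact ⟨h2, h1⟩

/-- Rank-nullity for `μ - μ.flip`, whose kernel is the centre. -/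
theorem finrank_innerDerivations_lt (μ : V →ₗ[ℂ] V →ₗ[ℂ] V) (z : V) (hz : z ≠ 0)
    (h : ∀ x, μ z x = μ x z) : Module.finrank ℂ (innerDerivations μ) < Module.finrank ℂ V := by
  have h1 := LinearMap.finrank_range_add_finrank_ker (μ - μ.flip)
  have hmem : z ∈ LinearMap.ker (μ - μ.flip) := by
    rw [LinearMap.mem_ker]
    ext x
    simp [h]
  have h2 : 0 < Module.finrank ℂ (LinearMap.ker (μ - μ.flip)) :=
    Module.finrank_pos_iff_exists_ne_zero.2 ⟨⟨z, hmem⟩, fun h0 => hz (congrArg Subtype.val h0)⟩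
  unfold innerDerivations
  omega

theorem finrank_le_finrank_innerDerivations_add_one (μ : V →ₗ[ℂ] V →ₗ[ℂ] V) (z : V)
    (h : ∀ w, (∀ x, μ w x = μ x w) → w ∈ Submodule.span ℂ {z}) :
    Module.finrank ℂ V ≤ Module.finrank ℂ (innerDerivations μ) + 1 := by
  have h1 := LinearMap.finrank_range_add_finrank_ker (μ - μ.flip)
  have hle : LinearMap.ker (μ - μ.flip) ≤ Submodule.span ℂ {z} := by
    intro w hw
    refine h w fun x => ?_
    simpa [sub_eq_zero] using LinearMap.congr_fun (LinearMap.mem_ker.1 hw) x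
  have h2 := (Submodule.finrank_mono hle).trans (finrank_span_le_card ({z} : Set V))
  rw [Set.toFinset_singleton, Finset.card_singleton] at h2
  unfold innerDerivations
  omega

end General

/-! ### Coordinates, the multiplication table and associativity. -/

def e1 : V5 := ![1, 0, 0, 0, 0]

/-- The standard basis vectors. -/
def e : Fin 5 → V5 := ![e1, e2, e3, e4, e5]

theorem eq_sum_smul (x : V5) :
    x = x 0 • e1 + x 1 • e2 + x 2 • e3 + x 3 • e4 + x 4 • e5 := by
  ext k
  fin_cases k <;> simp [e1, e2, e3, e4, e5]

theorem eq_zero_of_basis {d : V5 →ₗ[ℂ] V5} (h1 : d e1 = 0) (h2 : d e2 = 0) (h3 : d e3 = 0)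
    (h4 : d e4 = 0) (h5 : d e5 = 0) : d = 0 := by
  refine LinearMap.ext fun x => ?_
  rw [eq_sum_smul x]
  simp [h1, h2, h3, h4, h5]

/-- A space of endomorphisms whose elements are determined by the matrix entries in `S`. -/
theorem finrank_le_card {W : Submodule ℂ (V5 →ₗ[ℂ] V5)} (S : Finset (Fin 5 × Fin 5))
    (h : ∀ d ∈ W, (∀ p ∈ S, d (e p.1) p.2 = 0) → d = 0) : Module.finrank ℂ W ≤ S.card := by
  let L : W →ₗ[ℂ] (S → ℂ) :=
    { toFun := fun d p => d.1 (e p.1.1) p.1.2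
      map_add' := fun _ _ => rfl
      map_smul' := fun _ _ => rfl }
  have hL : Function.Injective L := by
    rw [injective_iff_map_eq_zero]
    intro d hd
    exact Subtype.ext (h d.1 d.2 fun p hp => congrFun hd ⟨p, hp⟩)
  simpa using LinearMap.finrank_le_finrank_of_injective hL

theorem le_finrank {n : ℕ} {W : Submodule ℂ (V5 →ₗ[ℂ] V5)} (L : (Fin n → ℂ) →ₗ[ℂ] (V5 →ₗ[ℂ] V5))
    (hL : ∀ v, L v = 0 → v = 0) (hW : ∀ v, L v ∈ W) : n ≤ Module.finrank ℂ W := by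
  have hi : Function.Injective (L.codRestrict W hW) := by
    rw [injective_iff_map_eq_zero]
    exact fun v hv => hL v (congrArg Subtype.val hv)
  simpa using LinearMap.finrank_le_finrank_of_injective hi

theorem mul_apply (A : Label) (x y : V5) : mul A x y = ∑ i, ∑ j, (x i * y j) • table A i j := rfl

theorem mul_e_e (A : Label) (i j : Fin 5) : mul A (e i) (e j) = table A i j := by
  have he : ∀ i k : Fin 5, e i k = if k = i then 1 else 0 := by
    intro i k
    fin_cases i <;> fin_cases k <;> simp [e, e1, e2, e3, e4, e5]
  simp [mul_apply, he]

theorem mul_apply_apply (A : Label) (x y : V5) (k : Fin 5) :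
    mul A x y k = ∑ i, ∑ j, x i * y j * table A i j k := by
  simp [mul_apply]

set_option maxHeartbeats 4000000 in
theorem mul_assoc (A : Label) (x y z : V5) : mul A (mul A x y) z = mul A x (mul A y z) := by
  have h := mul_apply_apply A
  ext k
  cases A <;>
    simp [Fin.forall_fin_succ, Fin.sum_univ_five, table, e2, e3, e4, e5, forall_and] at h <;>
    -- The last alternative is for `A29` and `A30`, where `I ^ 2 = -1` is needed.
    fin_cases k <;> simp [h] <;> first | done | ring1 | (ring_nf; simp; ring)

/-! ### Lower bounds, and the upper bound for Inn. -/

theorem two_le_finrank_centroid_mul (A : Label) : 2 ≤ Module.finrank ℂ (centroid (mul A)) := by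
  have h : ∃ z : V5, z ≠ 0 ∧ z 0 = 0 ∧ (∀ x, mul A z x = 0) ∧ (∀ x, mul A x z = 0) := by
    -- `e4` annihilates `A1` to `A4`, and `e3` annihilates all the others.
    have hA : (∀ i, table A 3 i = 0 ∧ table A i 3 = 0) ∨
        (∀ i, table A 2 i = 0 ∧ table A i 2 = 0) := by
      cases A <;> simp [Fin.forall_fin_succ, table]
    rcases hA with hA | hA
    · refine ⟨e4, fun h => by simpa [e4] using congrFun h 3, by simp [e4], fun x => ?_,
        fun x => ?_⟩ <;> simp [mul_apply, e4, Fin.sum_univ_five, hA]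
    · refine ⟨e3, fun h => by simpa [e3] using congrFun h 2, by simp [e3], fun x => ?_,
        fun x => ?_⟩ <;> simp [mul_apply, e3, Fin.sum_univ_five, hA]
  obtain ⟨z, hz, hz0, hl, hr⟩ := h
  refine two_le_finrank_centroid (mul A) (LinearMap.proj 0) z hz
    (fun h => by simpa [e1] using LinearMap.congr_fun h e1) hz0 (fun x y => ?_) hl hr
  have hT : ∀ i j, table A i j 0 = 0 := by
    cases A <;> simp [Fin.forall_fin_succ, table, e2, e3, e4, e5]
  simp [mul_apply_apply, hT]

theorem two_le_finrank_innerDerivations_mul (A : Label) :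
    2 ≤ Module.finrank ℂ (innerDerivations (mul A)) := by
  have h : ∃ i j k, table A i j k ≠ table A j i k := by
    have hA : table A 0 2 3 ≠ table A 2 0 3 ∨ table A 0 4 3 ≠ table A 4 0 3 ∨
        table A 0 3 1 ≠ table A 3 0 1 ∨ table A 0 3 2 ≠ table A 3 0 2 ∨
        table A 0 3 4 ≠ table A 3 0 4 ∨ table A 3 4 2 ≠ table A 4 3 2 := by
      cases A with
      | A9 α hα | A16 α hα | A17 α hα | A31 α hα => simp [table, e2, e3, e5, hα.symm]
      | A8 | A26 => simp [table, e2, e3, e5]; norm_num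
      | A29 | A30 => simp [table, e2, e3, e5, Complex.ext_iff]
      | _ => simp [table, e2, e3, e4, e5]
    rcases hA with hA | hA | hA | hA | hA | hA <;> exact ⟨_, _, _, hA⟩
  obtain ⟨i, j, k, h⟩ := h
  refine two_le_finrank_innerDerivations (mul A) (e i) (e j) ?_
  rw [mul_e_e, mul_e_e]
  exact fun h' => h (congrFun h' k)

theorem finrank_innerDerivations_mul_le (A : Label) :
    Module.finrank ℂ (innerDerivations (mul A)) ≤ 4 := by
  have h : ∃ z : V5, z ≠ 0 ∧ ∀ x, mul A z x = mul A x z := by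
    have hA : (∀ i, table A 3 i = table A i 3) ∨ (∀ i, table A 2 i = table A i 2) := by
      cases A <;> simp [Fin.forall_fin_succ, table]
    rcases hA with hA | hA
    · refine ⟨e4, fun h => by simpa [e4] using congrFun h 3, fun x => ?_⟩
      simp [mul_apply, e4, Fin.sum_univ_five, hA]
    · refine ⟨e3, fun h => by simpa [e3] using congrFun h 2, fun x => ?_⟩
      simp [mul_apply, e3, Fin.sum_univ_five, hA]
  obtain ⟨z, hz, h⟩ := h
  have := finrank_innerDerivations_lt (mul A) z hz h
  rw [Module.finrank_fin_fun] at this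
  omega

theorem two_le_finrank_derivations_mul (A : Label) :
    2 ≤ Module.finrank ℂ (derivations (mul A)) :=
  (two_le_finrank_innerDerivations_mul A).trans
    (Submodule.finrank_mono (innerDerivations_le_derivations _ (mul_assoc A)))

/-! ### Values that are attained. -/

theorem finrank_innerDerivations_A12 :
    Module.finrank ℂ (innerDerivations (mul .A12)) = 4 := by
  refine (finrank_innerDerivations_mul_le _).antisymm ?_
  -- Commuting with `e1` kills the `e4`- and `e5`-coordinates of `w`; commuting with `e4` kills the
  -- `e1`- and `e2`-coordinates.
  have h := finrank_le_finrank_innerDerivations_add_one (mul .A12) e3 fun w hw => by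
    have h1 := hw e1
    have h4 := hw e4
    simp [funext_iff, Fin.forall_fin_succ, mul_apply_apply, Fin.sum_univ_five, table, e1, e2, e3, e4,
      e5] at h1 h4
    rw [Submodule.mem_span_singleton]
    refine ⟨w 2, ?_⟩
    ext k
    fin_cases k <;> simp [e3, h1, ← h4.1, ← h4.2]
  rw [Module.finrank_fin_fun] at h
  omega

theorem finrank_innerDerivations_A1 :
    Module.finrank ℂ (innerDerivations (mul .A1)) = 2 := by
  -- In `A1` the only nonzero commutator of basis vectors, up to sign, is `[e1, e3] = e4`.
  refine le_antisymm (finrank_le_card {(0, 3), (2, 3)} fun d hd h => ?_)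
    (two_le_finrank_innerDerivations_mul _)
  obtain ⟨w, hw⟩ := (mem_innerDerivations _ d).1 hd
  refine LinearMap.ext fun x => ?_
  ext k
  simp [hw, mul_apply_apply, Fin.sum_univ_five, table, e, e1, e2, e3, e4, e5] at h
  fin_cases k <;> simp [hw, mul_apply_apply, Fin.sum_univ_five, table, e2, e4, h]
  ring

theorem eight_le_finrank_centroid_A2 :
    8 ≤ Module.finrank ℂ (centroid (mul .A2)) := by
  -- The generators are `e1`, `e3`, `e5`. The images of `e2` and `e4` are forced by `e1 e1 = e2` and
  -- `e1 e2 = e4`, and all eight parameters occur in the images of the generators.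
  let L : (Fin 8 → ℂ) →ₗ[ℂ] (V5 →ₗ[ℂ] V5) :=
    LinearMap.mk₂ ℂ (fun v x => ![v 0 * x 0, v 1 * x 0 + v 0 * x 1, v 0 * x 2,
      v 2 * x 0 + v 1 * x 1 + v 4 * x 2 + v 0 * x 3 + v 6 * x 4, v 3 * x 0 + v 5 * x 2 + v 7 * x 4])
      (fun _ _ _ => by ext k; fin_cases k <;> simp <;> ring)
      (fun _ _ _ => by ext k; fin_cases k <;> simp <;> ring)
      (fun _ _ _ => by ext k; fin_cases k <;> simp <;> ring)
      (fun _ _ _ => by ext k; fin_cases k <;> simp <;> ring)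
  have hL : ∀ v x, L v x = ![v 0 * x 0, v 1 * x 0 + v 0 * x 1, v 0 * x 2,
      v 2 * x 0 + v 1 * x 1 + v 4 * x 2 + v 0 * x 3 + v 6 * x 4, v 3 * x 0 + v 5 * x 2 + v 7 * x 4] :=
    fun _ _ => rfl
  clear_value L
  have h := mul_apply_apply .A2
  simp [Fin.forall_fin_succ, Fin.sum_univ_five, table, e2, e4, forall_and] at h
  refine le_finrank L (fun v hv => ?_) fun v x y => ?_
  · have h1 := LinearMap.congr_fun hv e1
    have h3 := LinearMap.congr_fun hv e3
    have h5 := LinearMap.congr_fun hv e5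
    simp [hL, e1, e3, e5] at h1 h3 h5
    ext k
    fin_cases k <;> simp [h1, h3, h5]
  · constructor <;> ext k <;> fin_cases k <;>
      simp [hL, h] <;> ring

theorem nine_le_finrank_derivations_A2 :
    9 ≤ Module.finrank ℂ (derivations (mul .A2)) := by
  -- The factors 2, 2, 3 on `v 0` are the weights of `e2`, `e3`, `e4` when `e1` has weight 1; `2 * v
  -- 1 + v 2` collects `e1 e2 + e2 e1` and `e1 e3`.
  let L : (Fin 9 → ℂ) →ₗ[ℂ] (V5 →ₗ[ℂ] V5) :=
    LinearMap.mk₂ ℂ (fun v x => ![v 0 * x 0, v 1 * x 0 + 2 * v 0 * x 1, v 2 * x 0 + 2 * v 0 * x 2,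
      v 3 * x 0 + (2 * v 1 + v 2) * x 1 + v 5 * x 2 + 3 * v 0 * x 3 + v 7 * x 4,
      v 4 * x 0 + v 6 * x 2 + v 8 * x 4])
      (fun _ _ _ => by ext k; fin_cases k <;> simp <;> ring)
      (fun _ _ _ => by ext k; fin_cases k <;> simp <;> ring)
      (fun _ _ _ => by ext k; fin_cases k <;> simp <;> ring)
      (fun _ _ _ => by ext k; fin_cases k <;> simp <;> ring)
  have hL : ∀ v x, L v x = ![v 0 * x 0, v 1 * x 0 + 2 * v 0 * x 1, v 2 * x 0 + 2 * v 0 * x 2,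
      v 3 * x 0 + (2 * v 1 + v 2) * x 1 + v 5 * x 2 + 3 * v 0 * x 3 + v 7 * x 4,
      v 4 * x 0 + v 6 * x 2 + v 8 * x 4] :=
    fun _ _ => rfl
  clear_value L
  have h := mul_apply_apply .A2
  simp [Fin.forall_fin_succ, Fin.sum_univ_five, table, e2, e4, forall_and] at h
  refine le_finrank L (fun v hv => ?_) fun v x y => ?_
  · have h1 := LinearMap.congr_fun hv e1
    have h3 := LinearMap.congr_fun hv e3
    have h5 := LinearMap.congr_fun hv e5
    simp [hL, e1, e3, e5] at h1 h3 h5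
    ext k
    fin_cases k <;> simp [h1, h3, h5]
  · ext k
    fin_cases k <;>
      simp [hL, h] <;> ring
-- Algebras generated by `e1` and `e4`.
section TwoGenerators

variable {A : Label} {d : V5 →ₗ[ℂ] V5}

theorem derivation_eq_zero_of_mul (hd : d ∈ derivations (mul A)) {x y z : V5}
    (hz : mul A x y = z) (hx : d x = 0) (hy : d y = 0) : d z = 0 := by
  rw [← hz, hd x y, hx, hy]
  simp

theorem centroid_eq_zero_of_mul (hd : d ∈ centroid (mul A)) {x y z : V5}
    (hz : mul A x y = z) (hx : d x = 0) : d z = 0 := by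
  rw [← hz, (hd x y).1, hx]
  simp

theorem eq_smul_e1 {x : V5} (h1 : x 1 = 0) (h2 : x 2 = 0) (h3 : x 3 = 0) (h4 : x 4 = 0) :
    x = x 0 • e1 := by
  conv_lhs => rw [eq_sum_smul x]
  simp [h1, h2, h3, h4]

theorem smul_e2_eq_zero {t : ℂ} (h : t • e2 = 0) : t = 0 := by
  simpa [e2] using congrFun h 1

/-- A derivation killing `e₁`, and sending `e₄` to a multiple of `e₁`, is zero if the algebra is
generated by `e₁` and `e₄` and its square is contained in the span of `e₂`, `e₃`, `e₅`. -/
theorem derivation_eq_zero_of_two_generators (h11 : mul A e1 e1 = e2) (h12 : mul A e1 e2 = e3)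
    (h : (mul A e1 e4 = e5 ∧ (∃ r s t : ℂ, mul A e4 e1 = r • e2 + s • e3 + t • e5) ∧
        ∃ r s t : ℂ, mul A e4 e4 = r • e2 + s • e3 + t • e5) ∨
      ((∃ t : ℂ, mul A e1 e4 = t • e3 ∨ mul A e4 e1 = t • e3) ∧
        (mul A e4 e1 = e5 ∨ mul A e4 e4 = e5)))
    (hd : d ∈ derivations (mul A)) (hd1 : d e1 = 0) {t : ℂ} (hd4 : d e4 = t • e1) : d = 0 := by
  have hd2 := derivation_eq_zero_of_mul hd h11 hd1 hd1
  have hd3 := derivation_eq_zero_of_mul hd h12 hd1 hd2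
  have h14 : d (mul A e1 e4) = t • e2 := by rw [hd, hd1, hd4]; simp [h11]
  have h41 : d (mul A e4 e1) = t • e2 := by rw [hd, hd1, hd4]; simp [h11]
  -- If `e1 e4 = e5`, then `d e5 = t e2`. With `c` the `e5`-coefficient of `e4 e1`, applying `d` to
  -- `e4 e1` gives `c t = t`, and the `e5`-coordinate of `d (e4 e4)` gives `t (1 + c) = 0`.
  -- Otherwise `d` kills a product that it must send to `t e2`.
  have ht : t = 0 := by
    rcases h with ⟨h5, ⟨a, b, c, h1⟩, a', b', c', h4⟩ | ⟨⟨s, h | h⟩, -⟩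
    · rw [h5] at h14
      have h44 := hd e4 e4
      simp only [h4, hd4, map_add, map_smul, hd2, hd3, h14, LinearMap.smul_apply, h1, h5] at h44
      simp only [h1, map_add, map_smul, hd2, hd3, h14] at h41
      have e44 := congrFun h44 4
      have e41 := congrFun h41 1
      simp [e2, e3, e5] at e44 e41
      grind
    · rw [h, map_smul, hd3, smul_zero] at h14
      exact smul_e2_eq_zero h14.symm
    · rw [h, map_smul, hd3, smul_zero] at h41
      exact smul_e2_eq_zero h41.symm
  rw [ht, zero_smul] at hd4
  have hd5 : d e5 = 0 := by
    rcases h with ⟨h5, -⟩ | ⟨-, h5 | h5⟩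
    · exact derivation_eq_zero_of_mul hd h5 hd1 hd4
    · exact derivation_eq_zero_of_mul hd h5 hd4 hd1
    · exact derivation_eq_zero_of_mul hd h5 hd4 hd4
  exact eq_zero_of_basis hd1 hd2 hd3 hd4 hd5

theorem centroid_eq_zero_of_two_generators (h11 : mul A e1 e1 = e2) (h12 : mul A e1 e2 = e3)
    (h : mul A e1 e4 = e5 ∨ mul A e4 e1 = e5 ∨ mul A e4 e4 = e5)
    (hd : d ∈ centroid (mul A)) (hd1 : d e1 = 0) {s t : ℂ} (hd4 : d e4 = s • e1 + t • e2) :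
    d = 0 := by
  have hd2 := centroid_eq_zero_of_mul hd h11 hd1
  have hd3 := centroid_eq_zero_of_mul hd h12 hd1
  -- This is `e1 (d e4) = (d e1) e4 = 0`, which makes two coefficients of `d e4` redundant.
  have h14 : s • e2 + t • e3 = 0 := by
    have := (hd e1 e4).1.symm.trans (hd e1 e4).2
    rw [hd1, hd4] at this
    simpa [h11, h12] using this.symm
  have hs : s = 0 := by simpa [e2, e3] using congrFun h14 1
  have ht : t = 0 := by simpa [e2, e3] using congrFun h14 2
  have hd4 : d e4 = 0 := by rw [hd4, hs, ht]; simp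
  have hd5 : d e5 = 0 := by
    rcases h with h5 | h5 | h5
    · exact centroid_eq_zero_of_mul hd h5 hd1
    · exact centroid_eq_zero_of_mul hd h5 hd4
    · exact centroid_eq_zero_of_mul hd h5 hd4
  exact eq_zero_of_basis hd1 hd2 hd3 hd4 hd5

theorem finrank_derivations_le_of_two_generators (h11 : mul A e1 e1 = e2) (h12 : mul A e1 e2 = e3)
    (h : (mul A e1 e4 = e5 ∧ (∃ r s t : ℂ, mul A e4 e1 = r • e2 + s • e3 + t • e5) ∧
        ∃ r s t : ℂ, mul A e4 e4 = r • e2 + s • e3 + t • e5) ∨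
      ((∃ t : ℂ, mul A e1 e4 = t • e3 ∨ mul A e4 e1 = t • e3) ∧
        (mul A e4 e1 = e5 ∨ mul A e4 e4 = e5))) :
    Module.finrank ℂ (derivations (mul A)) ≤ 9 := by
  refine finrank_le_card {(0, 0), (0, 1), (0, 2), (0, 3), (0, 4), (3, 1), (3, 2), (3, 3), (3, 4)}
    fun d hd hS => ?_
  simp [e] at hS
  refine derivation_eq_zero_of_two_generators h11 h12 h hd ?_ (eq_smul_e1 ?_ ?_ ?_ ?_)
  · rw [eq_sum_smul (d e1)]
    simp [hS]
  all_goals simp [hS]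

theorem finrank_centroid_le_of_two_generators (h11 : mul A e1 e1 = e2) (h12 : mul A e1 e2 = e3)
    (h : mul A e1 e4 = e5 ∨ mul A e4 e1 = e5 ∨ mul A e4 e4 = e5) :
    Module.finrank ℂ (centroid (mul A)) ≤ 8 := by
  refine finrank_le_card {(0, 0), (0, 1), (0, 2), (0, 3), (0, 4), (3, 2), (3, 3), (3, 4)}
    fun d hd hS => ?_
  simp [e] at hS
  refine centroid_eq_zero_of_two_generators (s := d e4 0) (t := d e4 1) h11 h12 h hd ?_ ?_
  · rw [eq_sum_smul (d e1)]
    simp [hS]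
  · conv_lhs => rw [eq_sum_smul (d e4)]
    simp [hS]

end TwoGenerators
-- The algebras `A1` to `A9` and `A11`.
section SpecialCases

variable {A : Label} {d : V5 →ₗ[ℂ] V5}

theorem basis_apply : (e1 0 = 1 ∧ e1 1 = 0 ∧ e1 2 = 0 ∧ e1 3 = 0 ∧ e1 4 = 0) ∧
    (e2 0 = 0 ∧ e2 1 = 1 ∧ e2 2 = 0 ∧ e2 3 = 0 ∧ e2 4 = 0) ∧
    (e3 0 = 0 ∧ e3 1 = 0 ∧ e3 2 = 1 ∧ e3 3 = 0 ∧ e3 4 = 0) ∧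
    (e4 0 = 0 ∧ e4 1 = 0 ∧ e4 2 = 0 ∧ e4 3 = 1 ∧ e4 4 = 0) ∧
    (e5 0 = 0 ∧ e5 1 = 0 ∧ e5 2 = 0 ∧ e5 3 = 0 ∧ e5 4 = 1) := by
  simp [e1, e2, e3, e4, e5]

theorem derivation_table (hd : d ∈ derivations (mul A)) (i j k : Fin 5) :
    d (table A i j) k =
      ∑ l, d (e i) l * table A l j k + ∑ l, d (e j) l * table A i l k := by
  have he : ∀ i k : Fin 5, e i k = if k = i then 1 else 0 := by
    intro i k
    fin_cases i <;> fin_cases k <;> simp [e, basis_apply]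
  rw [← mul_e_e, hd]
  simp [mul_apply_apply, he]

theorem centroid_table (hd : d ∈ centroid (mul A)) (i j k : Fin 5) :
    d (table A i j) k = ∑ l, d (e i) l * table A l j k ∧
      d (table A i j) k = ∑ l, d (e j) l * table A i l k := by
  have he : ∀ i k : Fin 5, e i k = if k = i then 1 else 0 := by
    intro i k
    fin_cases i <;> fin_cases k <;> simp [e, basis_apply]
  rw [← mul_e_e]
  constructor
  · rw [(hd _ _).1]
    simp [mul_apply_apply, he]
  · rw [(hd _ _).2]
    simp [mul_apply_apply, he]

theorem eq_zero_of_apply (h : ∀ i k, d (e i) k = 0) : d = 0 :=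
  eq_zero_of_basis (funext (h 0)) (funext (h 1)) (funext (h 2)) (funext (h 3)) (funext (h 4))

theorem finrank_derivations_A1_A2_le (hA : A = .A1 ∨ A = .A2) :
    Module.finrank ℂ (derivations (mul A)) ≤ 9 := by
  refine finrank_le_card {(0, 0), (0, 1), (0, 2), (0, 3), (0, 4), (2, 3), (2, 4), (4, 3), (4, 4)}
    fun d hd hS => eq_zero_of_apply ?_
  have h := derivation_table hd
  rcases hA with rfl | rfl
  all_goals
    simp [e] at hS
    have h11 := h 0 0
    have h12 := h 0 1
    have h13 := h 0 2
    have h31 := h 2 0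
    have h15 := h 0 4
    have h51 := h 4 0
    simp [Fin.forall_fin_succ, Fin.sum_univ_five, table, e, basis_apply, hS]
      at h11 h12 h13 h31 h15 h51
    simp [Fin.forall_fin_succ, e, hS]
    grind

/-- The entry `(0, 2)` is not needed: `φ e1` commutes with `e1`, whereas `e3` does not. -/
theorem finrank_centroid_A1_A2_le (hA : A = .A1 ∨ A = .A2) :
    Module.finrank ℂ (centroid (mul A)) ≤ 8 := by
  refine finrank_le_card {(0, 0), (0, 1), (0, 3), (0, 4), (2, 3), (2, 4), (4, 3), (4, 4)}
    fun d hd hS => eq_zero_of_apply ?_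
  have h := centroid_table hd
  rcases hA with rfl | rfl
  all_goals
    simp [e] at hS
    have h11 := h 0 0
    have h12 := h 0 1
    have h21 := h 1 0
    have h13 := h 0 2
    have h31 := h 2 0
    have h15 := h 0 4
    have h51 := h 4 0
    simp [Fin.forall_fin_succ, Fin.sum_univ_five, table, e, basis_apply, hS]
      at h11 h12 h21 h13 h31 h15 h51
    simp [Fin.forall_fin_succ, e, hS]
    grind

theorem finrank_derivations_A3_A4_le (hA : A = .A3 ∨ A = .A4) :
    Module.finrank ℂ (derivations (mul A)) ≤ 9 := by
  refine finrank_le_card {(0, 0), (0, 1), (0, 2), (0, 3), (0, 4), (4, 1), (4, 2), (4, 3), (4, 4)}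
    fun d hd hS => eq_zero_of_apply ?_
  have h := derivation_table hd
  rcases hA with rfl | rfl
  all_goals
    simp [e] at hS
    have h11 := h 0 0
    have h12 := h 0 1
    have h13 := h 0 2
    have h15 := h 0 4
    simp [Fin.forall_fin_succ, Fin.sum_univ_five, table, e, basis_apply, hS] at h11 h12 h13 h15
    simp [Fin.forall_fin_succ, e, hS]
    grind

theorem finrank_centroid_A3_A4_le (hA : A = .A3 ∨ A = .A4) :
    Module.finrank ℂ (centroid (mul A)) ≤ 8 := by
  refine finrank_le_card {(0, 0), (0, 1), (0, 2), (0, 3), (0, 4), (4, 2), (4, 3), (4, 4)}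
    fun d hd hS => eq_zero_of_apply ?_
  have h := centroid_table hd
  rcases hA with rfl | rfl
  all_goals
    simp [e] at hS
    have h11 := h 0 0
    have h12 := h 0 1
    have h13 := h 0 2
    have h15 := h 0 4
    simp [Fin.forall_fin_succ, Fin.sum_univ_five, table, e, basis_apply, hS] at h11 h12 h13 h15
    simp [Fin.forall_fin_succ, e, hS]
    grind

/-- Once `d e1 = 0`, multiplying `d e4` and `d e5` by `e1` on either side gives zero. As `e1` and
`e4` do not commute, this kills their coefficients at `e1`, `e2`, `e4`. -/
theorem finrank_derivations_A5_A6_A7_A11_le (hA : A = .A5 ∨ A = .A6 ∨ A = .A7 ∨ A = .A11) :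
    Module.finrank ℂ (derivations (mul A)) ≤ 9 := by
  refine finrank_le_card {(0, 0), (0, 1), (0, 2), (0, 3), (0, 4), (3, 2), (3, 4), (4, 2), (4, 4)}
    fun d hd hS => eq_zero_of_apply ?_
  have h := derivation_table hd
  rcases hA with rfl | rfl | rfl | rfl
  all_goals
    simp [e] at hS
    have h11 := h 0 0
    have h12 := h 0 1
    have h14 := h 0 3
    have h41 := h 3 0
    have h15 := h 0 4
    have h51 := h 4 0
    have h44 := h 3 3
    have h45 := h 3 4
    have h54 := h 4 3
    simp [Fin.forall_fin_succ, Fin.sum_univ_five, table, e, basis_apply, hS]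
      at h11 h12 h14 h41 h15 h51 h44 h45 h54
    simp [Fin.forall_fin_succ, e, hS]
    grind

theorem finrank_centroid_A11_le : Module.finrank ℂ (centroid (mul .A11)) ≤ 8 := by
  refine finrank_le_card {(0, 0), (0, 1), (0, 2), (0, 4), (3, 2), (3, 4), (4, 2), (4, 4)}
    fun d hd hS => eq_zero_of_apply ?_
  have h := centroid_table hd
  simp [e] at hS
  have h11 := h 0 0
  have h12 := h 0 1
  have h14 := h 0 3
  have h41 := h 3 0
  have h15 := h 0 4
  have h45 := h 3 4
  simp [Fin.forall_fin_succ, Fin.sum_univ_five, table, e, basis_apply, hS]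
    at h11 h12 h14 h41 h15 h45
  simp [Fin.forall_fin_succ, e, hS]
  grind

theorem finrank_derivations_A8_le : Module.finrank ℂ (derivations (mul .A8)) ≤ 9 := by
  refine finrank_le_card {(0, 0), (0, 1), (0, 2), (0, 3), (0, 4), (3, 2), (3, 3), (4, 2), (4, 3)}
    fun d hd hS => eq_zero_of_apply ?_
  have h := derivation_table hd
  simp [e] at hS
  have h11 := h 0 0
  have h12 := h 0 1
  have h14 := h 0 3
  have h15 := h 0 4
  have h41 := h 3 0
  have h51 := h 4 0
  have h45 := h 3 4
  have h55 := h 4 4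
  simp [Fin.forall_fin_succ, Fin.sum_univ_five, table, e, basis_apply, hS]
    at h11 h12 h14 h41 h15 h51 h45 h55
  simp [Fin.forall_fin_succ, e, hS]
  grind

/-- Comparing `d (e1 x)` with `d (x e1)` for `x = e4, e5` gives `1 - α` times the `e5`- or
`e4`-coefficient of `d e1`, so `α ≠ 1` makes both redundant and eight entries suffice. -/
theorem finrank_derivations_A9_le (α : ℂ) (hα : α ≠ 1) :
    Module.finrank ℂ (derivations (mul (.A9 α hα))) ≤ 9 := by
  refine (finrank_le_card {(0, 0), (0, 1), (0, 2), (3, 2), (3, 3), (3, 4), (4, 2), (4, 3)}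
    fun d hd hS => eq_zero_of_apply ?_).trans (by simp)
  have h := derivation_table hd
  simp [e] at hS
  have h11 := h 0 0
  have h12 := h 0 1
  have h14 := h 0 3
  have h41 := h 3 0
  have h15 := h 0 4
  have h51 := h 4 0
  have h45 := h 3 4
  simp [Fin.forall_fin_succ, Fin.sum_univ_five, table, e, basis_apply, hS]
    at h11 h12 h14 h41 h15 h51 h45
  simp [Fin.forall_fin_succ, e, hS]
  grind

/-- If `φ e1 = 0`, then `φ` kills all products, so its values annihilate the algebra and are
multiples of `e3`. -/
theorem finrank_centroid_A5_to_A9_le (hA : A = .A5 ∨ A = .A6 ∨ A = .A7 ∨ A = .A8 ∨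
    ∃ α hα, A = .A9 α hα) : Module.finrank ℂ (centroid (mul A)) ≤ 8 := by
  refine (finrank_le_card {(0, 0), (0, 1), (0, 2), (0, 3), (0, 4), (3, 2), (4, 2)}
    fun d hd hS => eq_zero_of_apply ?_).trans (by simp)
  have h := centroid_table hd
  rcases hA with rfl | rfl | rfl | rfl | ⟨α, hα, rfl⟩
  all_goals
    simp [e] at hS
    have h11 := h 0 0
    have h12 := h 0 1
    have h14 := h 0 3
    have h41 := h 3 0
    have h15 := h 0 4
    have h51 := h 4 0
    have h44 := h 3 3
    have h45 := h 3 4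
    have h54 := h 4 3
    have h55 := h 4 4
    simp [Fin.forall_fin_succ, Fin.sum_univ_five, table, e, basis_apply, hS]
      at h11 h12 h14 h41 h15 h51 h44 h45 h54 h55
    simp [Fin.forall_fin_succ, e, hS]
    grind

end SpecialCases

/-! ### Assembly of the upper bounds and the theorem. -/

theorem finrank_derivations_mul_le (A : Label) :
    Module.finrank ℂ (derivations (mul A)) ≤ 9 := by
  have h11 : mul A e1 e1 = table A 0 0 := mul_e_e A 0 0
  have h12 : mul A e1 e2 = table A 0 1 := mul_e_e A 0 1
  have h14 : mul A e1 e4 = table A 0 3 := mul_e_e A 0 3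
  have h41 : mul A e4 e1 = table A 3 0 := mul_e_e A 3 0
  have h44 : mul A e4 e4 = table A 3 3 := mul_e_e A 3 3
  have hspan : ∀ i j, table A i j 0 = 0 ∧ table A i j 3 = 0 →
      ∃ r s t : ℂ, table A i j = r • e2 + s • e3 + t • e5 := fun i j h =>
    ⟨table A i j 1, table A i j 2, table A i j 4,
      (eq_sum_smul (table A i j)).trans (by simp [h])⟩
  cases A with
  | A1 => exact finrank_derivations_A1_A2_le (Or.inl rfl)
  | A2 => exact finrank_derivations_A1_A2_le (Or.inr rfl)
  | A3 => exact finrank_derivations_A3_A4_le (Or.inl rfl)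
  | A4 => exact finrank_derivations_A3_A4_le (Or.inr rfl)
  | A5 | A6 | A7 | A11 => exact finrank_derivations_A5_A6_A7_A11_le (by simp)
  | A8 => exact finrank_derivations_A8_le
  | A9 α hα => exact finrank_derivations_A9_le α hα
  | A10 | A12 | A13 | A18 =>
    exact finrank_derivations_le_of_two_generators (by simp [h11, table]) (by simp [h12, table])
      (Or.inr ⟨⟨0, by simp [h14, table]⟩, by simp [h41, h44, table]⟩)
  | A19 =>
    exact finrank_derivations_le_of_two_generators (by simp [h11, table]) (by simp [h12, table])
      (Or.inr ⟨⟨0, by simp [h41, table]⟩, by simp [h44, table]⟩)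
  | _ =>
    exact finrank_derivations_le_of_two_generators (by simp [h11, table]) (by simp [h12, table])
      (Or.inl ⟨by simp [h14, table], by rw [h41]; exact hspan 3 0 (by simp [table, basis_apply]),
        by rw [h44]; exact hspan 3 3 (by simp [table, basis_apply])⟩)

theorem finrank_centroid_mul_le (A : Label) :
    Module.finrank ℂ (centroid (mul A)) ≤ 8 := by
  have h11 : mul A e1 e1 = table A 0 0 := mul_e_e A 0 0
  have h12 : mul A e1 e2 = table A 0 1 := mul_e_e A 0 1
  have h14 : mul A e1 e4 = table A 0 3 := mul_e_e A 0 3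
  have h41 : mul A e4 e1 = table A 3 0 := mul_e_e A 3 0
  have h44 : mul A e4 e4 = table A 3 3 := mul_e_e A 3 3
  cases A with
  | A1 => exact finrank_centroid_A1_A2_le (Or.inl rfl)
  | A2 => exact finrank_centroid_A1_A2_le (Or.inr rfl)
  | A3 => exact finrank_centroid_A3_A4_le (Or.inl rfl)
  | A4 => exact finrank_centroid_A3_A4_le (Or.inr rfl)
  | A5 | A6 | A7 | A8 => exact finrank_centroid_A5_to_A9_le (by simp)
  | A9 α hα => exact finrank_centroid_A5_to_A9_le (by simp [hα])
  | A11 => exact finrank_centroid_A11_le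
  | _ =>
    exact finrank_centroid_le_of_two_generators (by simp [h11, table]) (by simp [h12, table])
      (by simp [h14, h41, h44, table])

end NilpFive

theorem mainTheorem4 :
    (∀ A : NilpFive.Label,
      (2 ≤ Module.finrank ℂ (NilpFive.derivations (NilpFive.mul A)) ∧
        Module.finrank ℂ (NilpFive.derivations (NilpFive.mul A)) ≤ 9) ∧
      (2 ≤ Module.finrank ℂ (NilpFive.centroid (NilpFive.mul A)) ∧
        Module.finrank ℂ (NilpFive.centroid (NilpFive.mul A)) ≤ 8) ∧
      (2 ≤ Module.finrank ℂ (NilpFive.innerDerivations (NilpFive.mul A)) ∧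
        Module.finrank ℂ (NilpFive.innerDerivations (NilpFive.mul A)) ≤ 4)) ∧
    (∃ A : NilpFive.Label, Module.finrank ℂ (NilpFive.derivations (NilpFive.mul A)) = 9) ∧
    (∃ A : NilpFive.Label, Module.finrank ℂ (NilpFive.centroid (NilpFive.mul A)) = 8) ∧
    (∃ A : NilpFive.Label, Module.finrank ℂ (NilpFive.innerDerivations (NilpFive.mul A)) = 2) ∧
    (∃ A : NilpFive.Label, Module.finrank ℂ (NilpFive.innerDerivations (NilpFive.mul A)) = 4) :=
  open NilpFive in
  ⟨fun A => ⟨⟨two_le_finrank_derivations_mul A, finrank_derivations_mul_le A⟩,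
    ⟨two_le_finrank_centroid_mul A, finrank_centroid_mul_le A⟩,
    ⟨two_le_finrank_innerDerivations_mul A, finrank_innerDerivations_mul_le A⟩⟩,
    ⟨.A2, (finrank_derivations_mul_le _).antisymm nine_le_finrank_derivations_A2⟩,
    ⟨.A2, (finrank_centroid_mul_le _).antisymm eight_le_finrank_centroid_A2⟩,
    ⟨.A1, finrank_innerDerivations_A1⟩,
    ⟨.A12, finrank_innerDerivations_A12⟩⟩
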